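/- A graph is called strongly regular with parameters $(v,k,\lambda,\mu)$ if it is neither edgeless nor complete, has $v$ vertices, is $k$-regular, and any two distinct vertices have exactly $\lambda$ or exactly $\mu$ common neighbours according as they are adjacent or not. It is of Latin square type (resp. negative Latin square type) if $(v,k,\lambda,\mu)=(n^2,\ r(n-\epsilon),\ \epsilon n+r^2-3\epsilon r,\ r^2-\epsilon r)$ for some non-negative integers $n,r$, with $\epsilon=1$ (resp. $\epsilon=-1$). For a subset $D$ of an additive group $G$ with $0\notin D$ and $-D=D$, $\mathrm{Cay}(G,D)$ is the graph on $G$ in which $x,y$ are adjacent iff $x-y\in D$. Theorem. Let $q$ be a prime power, $e>1$ an integer dividing $q-1$, and $I\subseteq\{0,1,\dots,e-1\}$. Let $\gamma$ be a primitive element of $\mathbb F_{q^2}$ and let $\omega=\mathrm{Norm}_{q^2/q}(\gamma)\in\mathbb F_q$. Put $C_i^{(e,q^2)}=\gamma^i\langle\gamma^e\rangle$ and $C_i^{(e,q)}=\omega^i\langle\omega^e\rangle$ for $0\le i\le e-1$, and $E=\bigcup_{i\in I}C_i^{(e,q)}$. Suppose that $\mathrm{Cay}\bigl(\mathbb F_{q^2},\bigcup_{i\in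 I}C_i^{(e,q^2)}\bigr)$ is strongly regular of negative Latin square type. Let $m\ge 1$, and let $Q:\mathbb F_q^{2m}\to\mathbb F_q$ be a nonsingular quadratic form, i.e. the only $w$ with $Q(w)=0$ and $Q(v+w)-Q(v)-Q(w)=0$ for all $v$ is $w=0$. Put $D_E=\{x\in\mathbb F_q^{2m}: Q(x)\in E\}$. Then $0\notin D_E=-D_E$ and $\mathrm{Cay}(\mathbb F_q^{2m},D_E)$ is strongly regular. Moreover, it is of Latin square type if $Q$ is hyperbolic, i.e. equivalent under an invertible linear change of variables to $x_1x_2+x_3x_4+\cdots+x_{2m-1}x_{2m}$, and of negative Latin square type if $Q$ is elliptic, i.e. equivalent to $x_1x_2+\cdots+x_{2m-3}x_{2m-2}+(ax_{2m-1}^2+bx_{2m-1}x_{2m}+cx_{2m}^2)$ for some $a,b,c\in\mathbb F_q$ such that $aX^2+bXY+cY^2$ is irreducible over $\mathbb F_q$. -/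

import Mathlib

/-- `D` is admissible as the connection set of a (simple, undirected) Cayley graph on the additive
group `G`: it does not contain `0` and it is closed under negation. -/
def IsConnectionSet {G : Type*} [AddGroup G] (D : Set G) : Prop :=
  (0 : G) ∉ D ∧ ∀ x, x ∈ D → -x ∈ D

/-- For an admissible connection set, Mathlib's additive Cayley graph is the usual one:
two vertices are adjacent iff their difference lies in `D`. -/
theorem IsConnectionSet.addCayley_adj_iff {G : Type*} [AddCommGroup G] {D : Set G}
    (hD : IsConnectionSet D) (u v : G) : (SimpleGraph.addCayley D).Adj u v ↔ u - v ∈ D := by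
  rw [SimpleGraph.addCayley_adj']
  constructor
  · rintro ⟨-, g, hg, h | h⟩
    · have : u - v = -g := by rw [← h]; abel
      rw [this]
      exact hD.2 g hg
    · have : u - v = g := by rw [h]; abel
      rwa [this]
  · intro h
    refine ⟨?_, u - v, h, Or.inr (by abel)⟩
    rintro rfl
    exact hD.1 (by simpa using h)

open Classical in
/-- `G` is a strongly regular graph with parameters `(v, k, l, μ)`.  As usual, edgeless and
complete graphs are not counted as strongly regular. -/
def IsStronglyRegular {V : Type*} [Fintype V] (G : SimpleGraph V) (v k l μ : ℕ) : Prop :=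
  G.IsSRGWith v k l μ ∧ G ≠ ⊥ ∧ G ≠ ⊤

/-- `G` is a strongly regular graph whose parameters are
`(v, k, l, μ) = (n², r (n - ε), ε n + r² - 3 ε r, r² - ε r)` for natural numbers `n`, `r`. -/
def IsStronglyRegularOfType {V : Type*} [Fintype V] (ε : ℤ) (G : SimpleGraph V) : Prop :=
  ∃ v k l μ n r : ℕ, IsStronglyRegular G v k l μ ∧
    v = n ^ 2 ∧
    (k : ℤ) = r * (n - ε) ∧
    (l : ℤ) = ε * n + (r : ℤ) ^ 2 - 3 * ε * r ∧
    (μ : ℤ) = (r : ℤ) ^ 2 - ε * r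

/-- Strongly regular of Latin square type (`ε = 1`). -/
def IsLatinSquareType {V : Type*} [Fintype V] (G : SimpleGraph V) : Prop :=
  IsStronglyRegularOfType 1 G

/-- Strongly regular of negative Latin square type (`ε = -1`). -/
def IsNegLatinSquareType {V : Type*} [Fintype V] (G : SimpleGraph V) : Prop :=
  IsStronglyRegularOfType (-1) G

/-- The cyclotomic class `γ ^ i ⟨γ ^ e⟩`, as a subset of the field `K`. -/
def cyclotomicClass {K : Type*} [Field K] (γ : Kˣ) (e i : ℕ) : Set K :=
  {x | ∃ u ∈ Subgroup.zpowers (γ ^ e), x = ((γ ^ i * u : Kˣ) : K)}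

/-- The union of the cyclotomic classes of order `e` with index in `I`. -/
def cyclotomicUnion {K : Type*} [Field K] (γ : Kˣ) (e : ℕ) (I : Finset ℕ) : Set K :=
  ⋃ i ∈ I, cyclotomicClass γ e i

/-- A quadratic form is nonsingular if the only vector `w` with `Q w = 0` that is orthogonal to
everything with respect to the polar form is `0`. -/
def IsNonsingularForm {F V : Type*} [Field F] [AddCommGroup V] [Module F V]
    (Q : QuadraticForm F V) : Prop :=
  ∀ w : V, Q w = 0 → (∀ v : V, QuadraticMap.polar Q v w = 0) → w = 0

/-- The first coordinate of the `i`-th pair of coordinates (counting pairs from `0`). -/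
def pairFst {m : ℕ} (i : Fin m) : Fin (2 * m) := ⟨2 * i, by omega⟩

/-- The second coordinate of the `i`-th pair of coordinates (counting pairs from `0`). -/
def pairSnd {m : ℕ} (i : Fin m) : Fin (2 * m) := ⟨2 * i + 1, by omega⟩

/-- The quadratic form `x ↦ x j * x k`. -/
def coordMul (F : Type*) [Field F] {n : ℕ} (j k : Fin n) : QuadraticForm F (Fin n → F) :=
  QuadraticMap.linMulLin (LinearMap.proj j) (LinearMap.proj k)

/-- The standard hyperbolic form `x₁x₂ + x₃x₄ + ⋯ + x₂ₘ₋₁x₂ₘ`. -/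
def stdHyperbolic (F : Type*) [Field F] (m : ℕ) : QuadraticForm F (Fin (2 * m) → F) :=
  ∑ i : Fin m, coordMul F (pairFst i) (pairSnd i)

/-- The form `x₁x₂ + ⋯ + x₂ₘ₋₃x₂ₘ₋₂ + (a x₂ₘ₋₁² + b x₂ₘ₋₁x₂ₘ + c x₂ₘ²)`: the last pair of
coordinates carries the binary form with coefficients `a`, `b`, `c`. -/
def stdElliptic (F : Type*) [Field F] (m : ℕ) (a b c : F) : QuadraticForm F (Fin (2 * m) → F) :=
  ∑ i : Fin m,
    if (i : ℕ) + 1 < m then coordMul F (pairFst i) (pairSnd i)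
    else a • coordMul F (pairFst i) (pairFst i) + b • coordMul F (pairFst i) (pairSnd i)
      + c • coordMul F (pairSnd i) (pairSnd i)

/-- The binary form `a X² + b X Y + c Y²` as a polynomial in two variables. -/
noncomputable def binaryForm {F : Type*} [Field F] (a b c : F) : MvPolynomial (Fin 2) F :=
  MvPolynomial.C a * MvPolynomial.X 0 ^ 2
    + MvPolynomial.C b * MvPolynomial.X 0 * MvPolynomial.X 1
    + MvPolynomial.C c * MvPolynomial.X 1 ^ 2

/-- A quadratic form in `2m` variables is hyperbolic if it is equivalent to the standard
hyperbolic form. -/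
def IsHyperbolicForm {F : Type*} [Field F] {m : ℕ} (Q : QuadraticForm F (Fin (2 * m) → F)) :
    Prop :=
  QuadraticMap.Equivalent Q (stdHyperbolic F m)

/-- A quadratic form in `2m` variables is elliptic if it is equivalent to
`x₁x₂ + ⋯ + x₂ₘ₋₃x₂ₘ₋₂ + (a x₂ₘ₋₁² + b x₂ₘ₋₁x₂ₘ + c x₂ₘ²)` with the binary form
`a X² + b X Y + c Y²` irreducible over `F`. -/
def IsEllipticForm {F : Type*} [Field F] {m : ℕ} (Q : QuadraticForm F (Fin (2 * m) → F)) :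
    Prop :=
  ∃ a b c : F, Irreducible (binaryForm a b c) ∧ QuadraticMap.Equivalent Q (stdElliptic F m a b c)

/-! Fix a primitive additive character `ψ` of `F`, with `q = |F|`. The polar form of `Q` is
nondegenerate, and all Gauss sums `∑ ψ (s * Q x)`, `s ≠ 0`, equal `ε q ^ m` with one sign `ε = ±1`
(`IsNonsingularForm.exists_hasGaussSign`). Completing the square then shows that, for `d ≠ 0`, the
number of `x` with `Q x = t₁` and `Q (x - d) = t₂` depends only on `q`, `m`, `ε`, `Q d`, `t₁` and
`t₂`, through a correction term common to all forms (`card_sq_mul_card_pair`).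

The norm of the quadratic extension is an anisotropic binary form `N`, with `m = 1` and `ε = -1`,
and the given cyclotomic union is the preimage of `E` under `N`. Eliminating the correction term
between `Q` and `N` transfers the intersection counts (`card_pair_of_eq`). Nonzero `d` with `Q d =
0` have no counterpart for `N`; there the count is explicit and agrees with `μ`. The result has type
`ε` with `n = q ^ m`, `r = q ^ (m - 1) * |E|`, and evaluating one Gauss sum on a normal form
identifies `ε`. -/

section

/-! ### Nondegeneracy of the polar form in even dimension -/

open Finset QuadraticMap

/-- In the Leibniz expansion `σ` and `σ⁻¹` contribute equal terms, which cancel in characteristic 2.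
If `σ = σ⁻¹`, then `σ` is an involution of a set of odd size, so it has a fixed point and its term
contains a zero diagonal entry. -/
theorem det_eq_zero_of_symm_of_diag_eq_zero_of_odd {n R : Type*} [Fintype n] [DecidableEq n]
    [CommRing R] [CharP R 2] (A : Matrix n n R) (hsymm : ∀ i j, A i j = A j i)
    (hdiag : ∀ i, A i i = 0) (hodd : Odd (Fintype.card n)) : A.det = 0 := by
  rw [Matrix.det_apply']
  have hinv : ∀ σ : Equiv.Perm n, ∏ i, A (σ⁻¹ i) i = ∏ i, A (σ i) i := fun σ ↦ by
    rw [← Equiv.prod_comp σ]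
    exact prod_congr rfl fun i _ ↦ by simp [hsymm i]
  refine sum_involution (fun σ _ ↦ σ⁻¹) (fun σ _ ↦ ?_) (fun σ _ hσ h ↦ hσ ?_)
    (fun _ _ ↦ mem_univ _) (fun σ _ ↦ inv_inv σ)
  · rw [hinv, Equiv.Perm.sign_inv, CharTwo.add_self_eq_zero]
  · obtain ⟨i, hi⟩ : ∃ i, σ i = i := by
      by_contra! hne
      have : Even (Fintype.card n) := by
        have h2 : (univ : Finset n).card ≡ 0 [MOD 2] := by
          have := Equiv.Perm.card_fixedPoints_modEq (α := n) (f := (⇑σ : n → n)) (p := 2) (n := 1)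
            (by
              funext i
              change σ (σ i) = i
              nth_rewrite 1 [← h]
              simp)
          have hemp : IsEmpty (Function.fixedPoints (σ : n → n)) := ⟨fun x ↦ hne x x.2⟩
          rw [card_univ]
          refine this.trans ?_
          rw [Fintype.card_eq_zero_iff.2 hemp]
        exact Nat.even_iff.2 h2
      exact (Nat.not_even_iff_odd.2 hodd) this
    rw [prod_eq_zero (mem_univ i) (by rw [hi, hdiag]), mul_zero]

section

variable {F V : Type*} [Field F] [AddCommGroup V] [Module F V]

/-- Since `polar Q d d = 2 * Q d`, a nonzero radical vector `d` forces characteristic 2 and `Q d ≠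
0`. The polar form would then be alternating and nondegenerate on a hyperplane complementary to `d`,
whose dimension is odd. -/
theorem IsNonsingularForm.exists_polar_ne_zero [Fintype F] [FiniteDimensional F V] {Q : QuadraticForm F V}
    (hQ : IsNonsingularForm Q) (heven : Even (Module.finrank F V)) {d : V} (hd : d ≠ 0) :
    ∃ v, polar Q v d ≠ 0 := by
  by_contra! hrad
  have hQd : Q d ≠ 0 := fun h ↦ hd (hQ d h hrad)
  have h2 : (2 : F) = 0 := by
    have := hrad d
    rw [polar_self, nsmul_eq_mul, Nat.cast_ofNat] at this
    exact (mul_eq_zero.1 this).resolve_right hQd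
  have : CharP F 2 := CharTwo.of_one_ne_zero_of_two_eq_zero one_ne_zero h2
  obtain ⟨f, hf⟩ : ∃ f : Module.Dual F V, f d = 1 := by
    obtain ⟨f, hf⟩ : ∃ f : Module.Dual F V, f d ≠ 0 := by
      by_contra! h
      exact hd ((Module.forall_dual_apply_eq_zero_iff F d).1 h)
    exact ⟨(f d)⁻¹ • f, by simp [hf]⟩
  let W := LinearMap.ker f
  let B : LinearMap.BilinForm F W := Q.polarBilin.domRestrict₁₂ W W
  have hB : ∀ x y : W, B x y = polar Q x y := fun x y ↦ rfl
  have hrank : Module.finrank F W + 1 = Module.finrank F V := by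
    have h1 := f.finrank_range_add_finrank_ker
    have h3 : Module.finrank F (LinearMap.range f) = 1 := by
      rw [LinearMap.range_eq_top.2, finrank_top, Module.finrank_self]
      exact fun c ↦ ⟨c • d, by simp [hf]⟩
    have : Module.finrank F W = Module.finrank F (LinearMap.ker f) := rfl
    omega
  have hleft : ∀ w : W, (∀ y, B w y = 0) → w = 0 := by
    rintro ⟨w, hw⟩ h
    have hw' : f w = 0 := hw
    have hwrad : ∀ v, polar Q v w = 0 := fun v ↦ by
      have h1 := h ⟨v - f v • d, by simp [W, hf]⟩
      rw [hB] at h1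
      simp only [polar_sub_right, polar_smul_right, polar_comm Q w d] at h1
      have h4 := hrad w
      rw [polar_comm] at h4
      rw [h4, smul_zero, sub_zero] at h1
      rw [polar_comm, h1]
    -- Every element is a square here, so `t` can be chosen with `Q w + t ^ 2 * Q d = 0`; then `w +
    -- t • d` is a singular radical vector.
    obtain ⟨t, ht⟩ := FiniteField.isSquare_of_char_two (ringChar.eq F 2 ▸ rfl : ringChar F = 2)
      (Q w / Q d)
    have hzero : w + t • d = 0 := by
      apply hQ
      · rw [QuadraticMap.map_add Q, polar_smul_right, hrad, QuadraticMap.map_smul, ← ht,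
          smul_eq_mul, smul_zero, div_mul_cancel₀ _ hQd, add_zero, CharTwo.add_self_eq_zero]
      · intro v
        rw [polar_add_right, polar_smul_right, hrad, hwrad, smul_zero, add_zero]
    have ht0 : t = 0 := by simpa [hf, hw'] using congrArg f hzero
    rw [ht0, zero_smul, add_zero] at hzero
    exact Subtype.ext hzero
  have hsymm : ∀ x y, B x y = B y x := fun x y ↦ polar_comm _ _ _
  have hnd : B.Nondegenerate :=
    ⟨hleft, fun w h ↦ hleft w fun y ↦ by rw [hsymm, h y]⟩
  let b := Module.finBasis F W
  refine (LinearMap.BilinForm.nondegenerate_iff_det_ne_zero b).1 hnd ?_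
  apply det_eq_zero_of_symm_of_diag_eq_zero_of_odd
  · intro i j
    simp only [LinearMap.BilinForm.toMatrix_apply, hsymm (b i)]
  · intro i
    rw [LinearMap.BilinForm.toMatrix_apply, hB, polar_self, nsmul_eq_mul, Nat.cast_ofNat, h2,
      zero_mul]
  · rw [Fintype.card_fin]
    by_contra h
    rw [Nat.not_odd_iff_even] at h
    rw [← hrank] at heven
    exact (Nat.not_even_iff_odd.2 h.add_one) heven

/-! ### Gauss sums of quadratic forms -/

variable {ψ : AddChar F ℂ} {Q : QuadraticForm F V}

theorem sum_addChar_mul_polar_eq_zero [Fintype V] (hψ : ψ.IsPrimitive) {u : F} (hu : u ≠ 0) {d : V}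
    (hd : ∃ v, polar Q v d ≠ 0) : ∑ x, ψ (u * polar Q x d) = 0 := by
  obtain ⟨v, hv⟩ := hd
  let f : V →+ F := (u • Q.polarBilin.flip d).toAddMonoidHom
  have hne : ψ.compAddMonoidHom f ≠ 1 := by
    obtain ⟨a, ha⟩ := AddChar.ne_one_iff.1 (hψ one_ne_zero)
    refine AddChar.ne_one_iff.2 ⟨(a / (u * polar Q v d)) • v, ?_⟩
    have : f ((a / (u * polar Q v d)) • v) = a := by
      change u * polar Q ((a / (u * polar Q v d)) • v) d = a
      rw [polar_smul_left, smul_eq_mul]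
      field_simp
    rw [AddChar.compAddMonoidHom_apply, this]
    simpa using ha
  exact AddChar.sum_eq_zero_of_ne_one hne

/-- Writing the second variable as `y + d` leaves, for each `d`, a sum over `y` of the character `ψ
(s * polar Q y d)`, which vanishes unless `d = 0`. -/
theorem sum_addChar_mul_conj [Fintype F] [Fintype V] (hψ : ψ.IsPrimitive)
    (hQ : ∀ d : V, d ≠ 0 → ∃ v, polar Q v d ≠ 0) {s : F} (hs : s ≠ 0) :
    (∑ x, ψ (s * Q x)) * (starRingEnd ℂ) (∑ x, ψ (s * Q x)) = Fintype.card V := by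
  classical
  rw [map_sum, mul_comm, sum_mul_sum]
  have h1 : ∀ y : V, ∑ x, (starRingEnd ℂ) (ψ (s * Q y)) * ψ (s * Q x)
      = ∑ d, ψ (s * Q d) * ψ (s * polar Q y d) := fun y ↦ by
    rw [← Equiv.sum_comp (Equiv.addLeft y)]
    refine sum_congr rfl fun d _ ↦ ?_
    rw [← AddChar.map_neg_eq_conj, ← AddChar.map_add_eq_mul, ← AddChar.map_add_eq_mul,
      Equiv.coe_addLeft, QuadraticMap.map_add Q]
    ring_nf
  rw [sum_congr rfl fun y _ ↦ h1 y, sum_comm]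
  simp_rw [← mul_sum]
  rw [sum_eq_single 0]
  · simp
  · intro d _ hd
    rw [sum_addChar_mul_polar_eq_zero hψ hs (hQ d hd), mul_zero]
  · simp

end

section

variable {F : Type*} [Field F] [Fintype F] {ψ : AddChar F ℂ}

theorem AddChar.map_sum_eq_prod {ι A R : Type*} [AddCommMonoid A] [CommMonoid R] (φ : AddChar A R)
    (s : Finset ι) (f : ι → A) : φ (∑ i ∈ s, f i) = ∏ i ∈ s, φ (f i) :=
  map_prod φ.toMonoidHom (fun i ↦ Multiplicative.ofAdd (f i)) s

/-- An element `y` has `quadraticChar F y + 1` square roots, and the constant 1 contributes a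
vanishing character sum. -/
theorem sum_addChar_mul_sq_eq_quadraticChar [DecidableEq F] (hψ : ψ.IsPrimitive)
    (hF : ringChar F ≠ 2) {a : F} (ha : a ≠ 0) :
    ∑ x, ψ (a * x ^ 2) = ∑ y, (quadraticChar F y : ℂ) * ψ (a * y) := by
  have h1 : ∑ x, ψ (a * x ^ 2) = ∑ y, ((quadraticChar F y : ℂ) + 1) * ψ (a * y) := by
    rw [← sum_fiberwise (univ : Finset F) (fun x ↦ x ^ 2)]
    refine sum_congr rfl fun y _ ↦ ?_
    rw [sum_congr rfl (g := fun _ ↦ ψ (a * y)), sum_const, nsmul_eq_mul]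
    · congr 1
      have := quadraticChar_card_sqrts hF y
      have h2 : ({x : F | x ^ 2 = y} : Set F).toFinset = univ.filter fun x ↦ x ^ 2 = y := by
        ext; simp
      rw [h2] at this
      exact_mod_cast this
    · intro x hx
      rw [(mem_filter.1 hx).2]
  have h2 : ∑ y, ψ (a * y) = 0 := by
    have := AddChar.sum_mulShift a hψ
    simpa [ha, mul_comm] using this
  rw [h1]
  simp_rw [add_mul, one_mul, sum_add_distrib]
  rw [h2, add_zero]

theorem sum_addChar_mul_mul_sq [DecidableEq F] (hψ : ψ.IsPrimitive) (hF : ringChar F ≠ 2)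
    {s a : F} (hs : s ≠ 0) (ha : a ≠ 0) :
    ∑ x, ψ (s * (a * x ^ 2)) = (quadraticChar F s : ℂ) * ∑ x, ψ (a * x ^ 2) := by
  have h := sum_addChar_mul_sq_eq_quadraticChar hψ hF (mul_ne_zero hs ha)
  simp_rw [mul_assoc] at h
  rw [h, sum_addChar_mul_sq_eq_quadraticChar hψ hF ha, mul_sum,
    ← Equiv.sum_comp (Equiv.mulLeft₀ s hs) fun y ↦ (quadraticChar F s : ℂ) * (_ * ψ (a * y))]
  refine sum_congr rfl fun x _ ↦ ?_
  have h2 : (quadraticChar F s : ℂ) * quadraticChar F s = 1 := by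
    rw [← Int.cast_mul, ← pow_two, quadraticChar_sq_one hs, Int.cast_one]
  rw [Equiv.mulLeft₀_apply, map_mul (quadraticChar F), Int.cast_mul]
  rw [show a * (s * x) = s * (a * x) by ring]
  linear_combination (-(quadraticChar F x : ℂ) * ψ (s * (a * x))) * h2

variable {V W : Type*} [AddCommGroup V] [Module F V] [Fintype V] [AddCommGroup W] [Module F W]
  [Fintype W] {Q : QuadraticForm F V}

omit [Fintype F] in
theorem QuadraticMap.IsometryEquiv.sum_comp {M : Type*} [AddCommMonoid M]
    {Q' : QuadraticForm F W} (g : Q.IsometryEquiv Q') (f : F → M) :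
    ∑ x, f (Q x) = ∑ y, f (Q' y) := by
  rw [← Equiv.sum_comp g.toLinearEquiv.toEquiv fun y ↦ f (Q' y)]
  exact sum_congr rfl fun x _ ↦ congrArg f (g.map_app x).symm

/-- In characteristic 2, `s` is a square `t * t`, absorbed by `x ↦ t • x`. Otherwise `Q` is
diagonalised and each coordinate contributes a factor `quadraticChar F s`; their number is even. -/
theorem sum_addChar_mul_eq_sum_addChar (hψ : ψ.IsPrimitive)
    (hQ : ∀ d : V, d ≠ 0 → ∃ v, polar Q v d ≠ 0) (heven : Even (Module.finrank F V)) {s : F}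
    (hs : s ≠ 0) : ∑ x, ψ (s * Q x) = ∑ x, ψ (Q x) := by
  classical
  by_cases hF : ringChar F = 2
  · obtain ⟨t, rfl⟩ := FiniteField.isSquare_of_char_two hF s
    have ht : t ≠ 0 := by rintro rfl; simp at hs
    rw [← Equiv.sum_comp (LinearEquiv.smulOfNeZero F V t ht).toEquiv fun x ↦ ψ (Q x)]
    refine sum_congr rfl fun x _ ↦ ?_
    change _ = ψ (Q (t • x))
    rw [QuadraticMap.map_smul, smul_eq_mul]
  · have h2 : (2 : F) ≠ 0 := Ring.two_ne_zero hF
    let : Invertible (2 : F) := invertibleOfNonzero h2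
    have hsep : (associated (R := F) Q).SeparatingLeft := by
      intro d hd
      by_contra hne
      obtain ⟨v, hv⟩ := hQ d hne
      apply hv
      have h := LinearMap.congr_fun₂ (two_nsmul_associated F Q) d v
      rw [LinearMap.smul_apply, LinearMap.smul_apply, hd v, smul_zero] at h
      rw [polar_comm]
      exact h.symm
    obtain ⟨w, ⟨g⟩⟩ := QuadraticForm.equivalent_weightedSumSquares_units_of_nondegenerate' Q hsep
    have hsum : ∀ u : F, ∑ x, ψ (u * Q x) = ∏ i, ∑ x, ψ (u * (w i * x ^ 2)) := fun u ↦ by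
      rw [g.sum_comp fun t ↦ ψ (u * t), prod_univ_sum, Fintype.piFinset_univ]
      refine sum_congr rfl fun y _ ↦ ?_
      rw [weightedSumSquares_apply, mul_sum, ψ.map_sum_eq_prod]
      refine prod_congr rfl fun i _ ↦ ?_
      rw [Units.smul_def, smul_eq_mul, pow_two]
    have h1 := hsum 1
    simp only [one_mul] at h1
    rw [hsum, h1, prod_congr rfl fun i _ ↦ sum_addChar_mul_mul_sq hψ hF hs (w i).ne_zero,
      prod_mul_distrib, prod_const, card_univ, Fintype.card_fin]
    obtain ⟨k, hk⟩ := heven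
    have hk2 : (quadraticChar F s : ℂ) ^ Module.finrank F V = 1 := by
      rw [hk, ← two_mul, pow_mul, ← Int.cast_pow, quadraticChar_sq_one hs, Int.cast_one, one_pow]
    rw [hk2, one_mul]

theorem card_mul_card_fiber (hψ : ψ.IsPrimitive) [DecidableEq F] (t : F) :
    (Fintype.card F : ℂ) * #{x | Q x = t} = ∑ s, ψ (-(s * t)) * ∑ x, ψ (s * Q x) := by
  simp_rw [mul_sum]
  rw [sum_comm, card_filter, Nat.cast_sum, mul_sum]
  refine sum_congr rfl fun x _ ↦ ?_
  have := AddChar.sum_mulShift (Q x - t) hψ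
  rw [sum_congr rfl (g := fun s ↦ ψ (s * (Q x - t))), this]
  · simp [sub_eq_zero]
  · intro s _
    rw [← AddChar.map_add_eq_mul]
    ring_nf

theorem card_mul_card_fiber_of_sum_eq (hψ : ψ.IsPrimitive) [DecidableEq F] {G : ℂ}
    (hG : ∀ s : F, s ≠ 0 → ∑ x, ψ (s * Q x) = G) (t : F) :
    (Fintype.card F : ℂ) * #{x | Q x = t} =
      Fintype.card V + G * if t = 0 then (Fintype.card F : ℂ) - 1 else -1 := by
  have hsum : ∑ s ∈ univ.erase 0, ψ (-(s * t)) =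
      if t = 0 then (Fintype.card F : ℂ) - 1 else -1 := by
    have h := AddChar.sum_mulShift (-t) hψ
    simp_rw [mul_neg] at h
    rw [sum_erase_eq_sub (mem_univ (0 : F)), h]
    rcases eq_or_ne t 0 with rfl | ht <;> simp [*]
  rw [card_mul_card_fiber hψ, ← add_sum_erase _ _ (mem_univ (0 : F)), ← hsum]
  have h0 : ψ (-(0 * t)) * ∑ x, ψ (0 * Q x) = Fintype.card V := by simp
  have h1 : ∑ s ∈ univ.erase 0, ψ (-(s * t)) * ∑ x, ψ (s * Q x) =
      ∑ s ∈ univ.erase 0, G * ψ (-(s * t)) := by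
    refine sum_congr rfl fun s hs ↦ ?_
    rw [hG s (ne_of_mem_erase hs), mul_comm]
  rw [h0, h1, mul_sum]

/-- `Q` is a nondegenerate form on a space of dimension `2 * m` whose Gauss sums all equal
`ε * q ^ m`. -/
structure HasGaussSign (ψ : AddChar F ℂ) (Q : QuadraticForm F V) (m : ℕ) (ε : ℤ) : Prop where
  card_eq : Fintype.card V = Fintype.card F ^ (2 * m)
  exists_polar_ne_zero : ∀ d : V, d ≠ 0 → ∃ v, polar Q v d ≠ 0
  sum_eq : ∀ s : F, s ≠ 0 → ∑ x, ψ (s * Q x) = ε * (Fintype.card F : ℂ) ^ m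

/-- The common Gauss sum has absolute value `q ^ m`. It is real because counting the zeros of `Q`
expresses it rationally in terms of integers, so it is `± q ^ m`. -/
theorem IsNonsingularForm.exists_hasGaussSign (hψ : ψ.IsPrimitive) (hQ : IsNonsingularForm Q)
    {m : ℕ} (hm : Module.finrank F V = 2 * m) :
    ∃ ε : ℤ, (ε = 1 ∨ ε = -1) ∧ HasGaussSign ψ Q m ε := by
  classical
  have heven : Even (Module.finrank F V) := ⟨m, by omega⟩
  have hpolar : ∀ d : V, d ≠ 0 → ∃ v, polar Q v d ≠ 0 := fun d hd ↦
    hQ.exists_polar_ne_zero heven hd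
  have hcard : Fintype.card V = Fintype.card F ^ (2 * m) := by
    rw [Module.card_eq_pow_finrank (K := F), hm]
  have hconst : ∀ s : F, s ≠ 0 → ∑ x, ψ (s * Q x) = ∑ x, ψ (Q x) := fun s hs ↦
    sum_addChar_mul_eq_sum_addChar hψ hpolar heven hs
  set G := ∑ x, ψ (Q x) with hG
  have hnorm : G * (starRingEnd ℂ) G = ((Fintype.card F : ℂ) ^ m) ^ 2 := by
    have := sum_addChar_mul_conj hψ hpolar one_ne_zero
    simp only [one_mul] at this
    rw [hG, this, hcard]
    push_cast
    ring
  have hreal : (starRingEnd ℂ) G = G := by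
    have h := card_mul_card_fiber_of_sum_eq hψ hconst 0
    rw [if_pos rfl] at h
    have hne : (Fintype.card F : ℂ) - 1 ≠ 0 := by
      rw [sub_ne_zero]
      exact_mod_cast Fintype.one_lt_card.ne'
    have h2 : G = ((Fintype.card F : ℂ) * #{x | Q x = 0} - Fintype.card V)
        / ((Fintype.card F : ℂ) - 1) := by
      rw [eq_div_iff hne, h]
      ring
    rw [h2]
    simp
  rw [hreal, ← pow_two, sq_eq_sq_iff_eq_or_eq_neg] at hnorm
  rcases hnorm with h | h
  · exact ⟨1, Or.inl rfl, hcard, hpolar, fun s hs ↦ by rw [hconst s hs, h]; simp⟩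
  · exact ⟨-1, Or.inr rfl, hcard, hpolar, fun s hs ↦ by rw [hconst s hs, h]; simp⟩

end

/-! ### Two-point counts and their dependence on the form -/

section

variable {F V : Type*} [Field F] [Fintype F] [AddCommGroup V] [Module F V] [Fintype V]
  {ψ : AddChar F ℂ} {Q : QuadraticForm F V} {m : ℕ} {ε : ℤ}

namespace HasGaussSign

theorem card_mul_card_fiber [DecidableEq F] (h : HasGaussSign ψ Q m ε) (hψ : ψ.IsPrimitive)
    (t : F) : (Fintype.card F : ℤ) * #{x | Q x = t} =
      (Fintype.card F : ℤ) ^ (2 * m) +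
        ε * (Fintype.card F : ℤ) ^ m * if t = 0 then (Fintype.card F : ℤ) - 1 else -1 := by
  have := card_mul_card_fiber_of_sum_eq hψ h.sum_eq t
  rw [h.card_eq] at this
  rw [← Int.cast_inj (α := ℂ)]
  push_cast at this ⊢
  rw [this]

open Classical in
/-- The normalised value of `∑ x, ψ (s * Q x + u * Q (x - d))` when `Q d = a`. -/
noncomputable def pairKernel (ψ : AddChar F ℂ) (a s u : F) : ℂ :=
  if s + u = 0 then 0 else ψ (a * (s * u / (s + u)))

/-- If `s + u ≠ 0`, complete the square. If `s + u = 0`, the quadratic terms cancel and a linear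
character remains, whose sum vanishes unless `s = 0`. -/
theorem sum_addChar_pair [DecidableEq F] (h : HasGaussSign ψ Q m ε) (hψ : ψ.IsPrimitive) {d : V}
    (hd : d ≠ 0) (s u : F) :
    ∑ x, ψ (s * Q x + u * Q (x - d)) =
      (if s = 0 ∧ u = 0 then (Fintype.card F : ℂ) ^ (2 * m) else 0) +
        ε * (Fintype.card F : ℂ) ^ m * pairKernel ψ (Q d) s u := by
  have hsub : ∀ x, Q (x - d) = Q x + Q d - polar Q x d := fun x ↦ by
    rw [sub_eq_add_neg, QuadraticMap.map_add Q, polar_neg_right, QuadraticMap.map_neg]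
    ring
  by_cases hsu : s + u = 0
  · obtain rfl : u = -s := (neg_eq_of_add_eq_zero_right hsu).symm
    rw [pairKernel, if_pos hsu, mul_zero, add_zero]
    split_ifs with h0
    · rw [h0.1]
      simp [h.card_eq]
    · have hs : s ≠ 0 := fun hs ↦ h0 ⟨hs, by rw [hs, neg_zero]⟩
      have h1 : ∀ x, ψ (s * Q x + -s * Q (x - d)) = ψ (-(s * Q d)) * ψ (s * polar Q x d) :=
        fun x ↦ by
          rw [← AddChar.map_add_eq_mul, hsub]
          ring_nf
      simp_rw [h1]
      rw [← mul_sum, sum_addChar_mul_polar_eq_zero hψ hs (h.exists_polar_ne_zero d hd), mul_zero]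
  · have h0 : ¬(s = 0 ∧ u = 0) := fun h0 ↦ hsu (by rw [h0.1, h0.2, add_zero])
    rw [pairKernel, if_neg hsu, if_neg h0, zero_add, ← h.sum_eq _ hsu, sum_mul,
      -- This shift cancels the terms polar in `x` and `d`, leaving `(s + u) * Q x + s * u / (s + u)
      -- * Q d`.
      ← Equiv.sum_comp (Equiv.addRight ((u / (s + u)) • d))]
    refine sum_congr rfl fun x _ ↦ ?_
    rw [← AddChar.map_add_eq_mul, hsub, Equiv.coe_addRight, QuadraticMap.map_add Q,
      polar_add_left, polar_smul_left, polar_smul_right, QuadraticMap.map_smul, polar_self,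
      smul_eq_mul, smul_eq_mul, smul_eq_mul, nsmul_eq_mul, Nat.cast_ofNat]
    congr 1
    field_simp
    ring

/-- The normalised part of the two-point count that depends on the form. -/
noncomputable def pairCorrection (ψ : AddChar F ℂ) (a t₁ t₂ : F) : ℂ :=
  ∑ s, ∑ u, ψ (-(s * t₁ + u * t₂)) * pairKernel ψ a s u

theorem card_sq_mul_card_pair [DecidableEq F] (h : HasGaussSign ψ Q m ε) (hψ : ψ.IsPrimitive)
    {d : V} (hd : d ≠ 0) (t₁ t₂ : F) :
    (Fintype.card F : ℂ) ^ 2 * #{x | Q x = t₁ ∧ Q (x - d) = t₂} =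
      (Fintype.card F : ℂ) ^ (2 * m) +
        ε * (Fintype.card F : ℂ) ^ m * pairCorrection ψ (Q d) t₁ t₂ := by
  have hind : ∀ t : F, ∑ s, ψ (s * t) = if t = 0 then (Fintype.card F : ℂ) else 0 := fun t ↦ by
    rw [AddChar.sum_mulShift t hψ]
    split_ifs <;> simp
  have h1 : (Fintype.card F : ℂ) ^ 2 * #{x | Q x = t₁ ∧ Q (x - d) = t₂} =
      ∑ x, (∑ s, ψ (s * (Q x - t₁))) * ∑ u, ψ (u * (Q (x - d) - t₂)) := by
    rw [card_filter, Nat.cast_sum, mul_sum]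
    refine sum_congr rfl fun x _ ↦ ?_
    rw [hind, hind]
    by_cases h1 : Q x = t₁ <;> by_cases h2 : Q (x - d) = t₂ <;>
      simp [h1, h2, pow_two, sub_eq_zero]
  have h2 : ∑ x, (∑ s, ψ (s * (Q x - t₁))) * ∑ u, ψ (u * (Q (x - d) - t₂)) =
      ∑ s, ∑ u, ψ (-(s * t₁ + u * t₂)) * ∑ x, ψ (s * Q x + u * Q (x - d)) := by
    simp_rw [sum_mul_sum, mul_sum]
    rw [sum_comm]
    refine sum_congr rfl fun s _ ↦ ?_
    rw [sum_comm]
    refine sum_congr rfl fun u _ ↦ sum_congr rfl fun x _ ↦ ?_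
    rw [← AddChar.map_add_eq_mul, ← AddChar.map_add_eq_mul]
    ring_nf
  rw [h1, h2]
  simp_rw [h.sum_addChar_pair hψ hd, mul_add, sum_add_distrib]
  congr 1
  · rw [sum_eq_single 0, sum_eq_single 0]
    · simp
    · intro u _ hu
      simp [hu]
    · simp
    · intro s _ hs
      exact sum_eq_zero fun u _ ↦ by simp [hs]
    · simp
  · rw [pairCorrection]
    simp_rw [mul_sum]
    refine sum_congr rfl fun s _ ↦ sum_congr rfl fun u _ ↦ ?_
    ring

/-- For `a = 0` the kernel is 1 off the line `s + u = 0` and 0 on it. The full sum over `u` vanishes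
because `t₂ ≠ 0`, so only minus the sum over that line survives. -/
theorem pairCorrection_zero [DecidableEq F] (hψ : ψ.IsPrimitive) {t₁ t₂ : F} (ht : t₂ ≠ 0) :
    pairCorrection ψ 0 t₁ t₂ = if t₁ = t₂ then -(Fintype.card F : ℂ) else 0 := by
  have h1 : ∀ s : F, ∑ u, ψ (-(s * t₁ + u * t₂)) * pairKernel ψ 0 s u =
      -ψ (s * (t₂ - t₁)) := fun s ↦ by
    have h2 : ∑ u, ψ (-(s * t₁ + u * t₂)) = 0 := by
      have h3 := AddChar.sum_mulShift (-t₂) hψ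
      rw [if_neg (neg_ne_zero.2 ht), Nat.cast_zero] at h3
      rw [← mul_zero (ψ (-(s * t₁))), ← h3, mul_sum]
      refine sum_congr rfl fun u _ ↦ ?_
      rw [← AddChar.map_add_eq_mul]
      ring_nf
    have h4 : ∀ u : F, ψ (-(s * t₁ + u * t₂)) * pairKernel ψ 0 s u =
        ψ (-(s * t₁ + u * t₂)) - if u = -s then ψ (s * (t₂ - t₁)) else 0 := fun u ↦ by
      rw [pairKernel]
      by_cases hu : u = -s
      · rw [if_pos hu, if_pos (by rw [hu, add_neg_cancel]), mul_zero, hu]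
        ring_nf
      · rw [if_neg hu, if_neg (fun h ↦ hu (eq_neg_of_add_eq_zero_right h)), zero_mul,
          AddChar.map_zero_eq_one, mul_one, sub_zero]
    simp_rw [h4]
    rw [sum_sub_distrib, h2, sum_ite_eq' univ, if_pos (mem_univ _), zero_sub]
  rw [pairCorrection]
  simp_rw [h1]
  rw [sum_neg_distrib, AddChar.sum_mulShift _ hψ]
  by_cases h : t₁ = t₂
  · simp [h]
  · rw [if_neg h, if_neg (sub_ne_zero.2 (Ne.symm h))]
    simp

/-- The number of pairs of points with `Q`-values in `E` and difference `d`. -/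
theorem card_sq_mul_card_pair_finset [DecidableEq F] (h : HasGaussSign ψ Q m ε)
    (hψ : ψ.IsPrimitive) {d : V} (hd : d ≠ 0) (E : Finset F) :
    (Fintype.card F : ℂ) ^ 2 * #{x | Q x ∈ E ∧ Q (x - d) ∈ E} =
      (Fintype.card F : ℂ) ^ (2 * m) * #E ^ 2 +
        ε * (Fintype.card F : ℂ) ^ m * ∑ t₁ ∈ E, ∑ t₂ ∈ E, pairCorrection ψ (Q d) t₁ t₂ := by
  have h1 : #{x | Q x ∈ E ∧ Q (x - d) ∈ E} =
      ∑ t₁ ∈ E, ∑ t₂ ∈ E, #{x | Q x = t₁ ∧ Q (x - d) = t₂} := by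
    rw [← sum_product' E E fun t₁ t₂ ↦ #{x | Q x = t₁ ∧ Q (x - d) = t₂},
      card_eq_sum_card_fiberwise (f := fun x ↦ (Q x, Q (x - d))) (t := E ×ˢ E)]
    · refine sum_congr rfl fun t ht ↦ congrArg card ?_
      ext x
      simp only [mem_filter, mem_univ, true_and, Prod.ext_iff]
      rw [mem_product] at ht
      constructor
      · exact fun h ↦ h.2
      · rintro ⟨h1, h2⟩
        exact ⟨⟨h1 ▸ ht.1, h2 ▸ ht.2⟩, h1, h2⟩
    · intro x hx
      simpa using hx
  rw [h1]
  push_cast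
  simp_rw [mul_sum, h.card_sq_mul_card_pair hψ hd, sum_add_distrib]
  simp only [sum_const, nsmul_eq_mul]
  ring

theorem card_pair_of_eq_zero [DecidableEq F] (h : HasGaussSign ψ Q m ε) (hψ : ψ.IsPrimitive)
    {d : V} (hd : d ≠ 0) (hQd : Q d = 0) {E : Finset F} (hE : (0 : F) ∉ E) :
    (Fintype.card F : ℤ) ^ 2 * #{x | Q x ∈ E ∧ Q (x - d) ∈ E} =
      (Fintype.card F : ℤ) ^ (2 * m) * #E ^ 2 - ε * (Fintype.card F : ℤ) ^ (m + 1) * #E := by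
  have h1 := h.card_sq_mul_card_pair_finset hψ hd E
  have h2 : ∑ t₁ ∈ E, ∑ t₂ ∈ E, pairCorrection ψ (Q d) t₁ t₂ = -(#E * (Fintype.card F : ℂ)) := by
    rw [hQd, ← mul_neg, ← nsmul_eq_mul, ← sum_const]
    refine sum_congr rfl fun t₁ ht₁ ↦ ?_
    rw [sum_congr rfl fun t₂ ht₂ ↦ pairCorrection_zero hψ (ne_of_mem_of_not_mem ht₂ hE),
      sum_ite_eq, if_pos ht₁]
  rw [h2] at h1
  rw [← Int.cast_inj (α := ℂ)]
  push_cast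
  rw [h1]
  ring

/-- As `Q d = N c`, both counts involve the same correction sum; solving for it in the identity for
`N` gives the count for `Q`. -/
theorem card_pair_of_eq [DecidableEq F] (h : HasGaussSign ψ Q m ε) (hψ : ψ.IsPrimitive)
    {W : Type*} [AddCommGroup W] [Module F W] [Fintype W] {N : QuadraticForm F W}
    (hN : HasGaussSign ψ N 1 (-1)) {d : V} (hd : d ≠ 0) {c : W} (hc : c ≠ 0) (hQN : Q d = N c)
    (E : Finset F) :
    (Fintype.card F : ℤ) ^ 2 * #{x | Q x ∈ E ∧ Q (x - d) ∈ E} =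
      (Fintype.card F : ℤ) ^ (2 * m) * #E ^ 2 + ε * (Fintype.card F : ℤ) ^ (m + 1) *
        (#E ^ 2 - #{y | N y ∈ E ∧ N (y - c) ∈ E}) := by
  have h1 := h.card_sq_mul_card_pair_finset hψ hd E
  have h2 := hN.card_sq_mul_card_pair_finset hψ hc E
  have hq : (Fintype.card F : ℂ) ≠ 0 := by exact_mod_cast Fintype.card_ne_zero
  rw [← hQN] at h2
  rw [← Int.cast_inj (α := ℂ)]
  push_cast at h1 h2 ⊢
  have h3 : ∑ t₁ ∈ E, ∑ t₂ ∈ E, pairCorrection ψ (Q d) t₁ t₂ =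
      (Fintype.card F : ℂ) * (#E ^ 2 - #{y | N y ∈ E ∧ N (y - c) ∈ E}) := by
    apply mul_left_cancel₀ hq
    linear_combination h2
  rw [h1, h3]
  ring

/-- The zero fibre is a single point, so the fibre formula reads `q = q ^ 2 + ε * q * (q - 1)`. -/
theorem eq_neg_one_of_anisotropic [DecidableEq F] (h : HasGaussSign ψ Q 1 ε) (hψ : ψ.IsPrimitive)
    (hQ : Q.Anisotropic) : ε = -1 := by
  have h1 := h.card_mul_card_fiber hψ 0
  have h2 : (univ.filter fun x ↦ Q x = 0) = {0} := by
    ext x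
    simp [hQ.eq_zero_iff]
  rw [h2, if_pos rfl, card_singleton] at h1
  have hq : (1 : ℤ) < Fintype.card F := by exact_mod_cast Fintype.one_lt_card
  have h3 : ((Fintype.card F : ℤ) * (Fintype.card F - 1)) * (ε + 1) = 0 := by
    push_cast at h1
    linear_combination -h1
  rcases mul_eq_zero.1 h3 with h4 | h4
  · nlinarith
  · omega

end HasGaussSign

theorem QuadraticMap.Anisotropic.hasGaussSign (hψ : ψ.IsPrimitive) (hQ : Q.Anisotropic)
    (hrank : Module.finrank F V = 2) : HasGaussSign ψ Q 1 (-1) := by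
  classical
  have hns : IsNonsingularForm Q := fun w hw _ ↦ hQ w hw
  obtain ⟨ε, -, hε⟩ := hns.exists_hasGaussSign hψ (m := 1) hrank
  rwa [← hε.eq_neg_one_of_anisotropic hψ hQ]

end

/-! ### Signs of the hyperbolic and elliptic normal forms -/

/-- Grouping the coordinates of a vector of length `2 * m` into consecutive pairs. -/
def pairCoordsEquiv (F : Type*) (m : ℕ) : (Fin (2 * m) → F) ≃ (Fin m → F × F) where
  toFun x i := (x (pairFst i), x (pairSnd i))
  invFun f j := if (j : ℕ) % 2 = 0 then (f ⟨j / 2, by omega⟩).1 else (f ⟨j / 2, by omega⟩).2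
  left_inv x := by
    funext j
    dsimp only
    split_ifs with h
    · exact congrArg x (Fin.ext (by simp only [pairFst]; omega))
    · exact congrArg x (Fin.ext (by simp only [pairSnd]; omega))
  right_inv f := by
    funext i
    have h1 : ((pairFst i : Fin (2 * m)) : ℕ) = 2 * i := rfl
    have h2 : ((pairSnd i : Fin (2 * m)) : ℕ) = 2 * i + 1 := rfl
    have h3 : 2 * (i : ℕ) / 2 = i := by omega
    have h4 : (2 * (i : ℕ) + 1) / 2 = i := by omega
    have h5 : (2 * (i : ℕ) + 1) % 2 = 1 := by omega
    simp [h1, h2, h3, h4, h5]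

section

variable {F : Type*} [Field F] [Fintype F] {ψ : AddChar F ℂ} {m : ℕ}

theorem sum_addChar_sum_pairs (ψ : AddChar F ℂ) (β : Fin m → F → F → F) :
    ∑ x : Fin (2 * m) → F, ψ (∑ i, β i (x (pairFst i)) (x (pairSnd i))) =
      ∏ i, ∑ p : F × F, ψ (β i p.1 p.2) := by
  classical
  rw [prod_univ_sum, Fintype.piFinset_univ, ← Equiv.sum_comp (pairCoordsEquiv F m)]
  exact sum_congr rfl fun x _ ↦ ψ.map_sum_eq_prod _ _

theorem sum_addChar_mul (hψ : ψ.IsPrimitive) :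
    ∑ p : F × F, ψ (p.1 * p.2) = Fintype.card F := by
  classical
  rw [Fintype.sum_prod_type_right]
  simp_rw [AddChar.sum_mulShift _ hψ]
  simp

theorem sum_addChar_stdHyperbolic (hψ : ψ.IsPrimitive) (m : ℕ) :
    ∑ x, ψ (stdHyperbolic F m x) = (Fintype.card F : ℂ) ^ m := by
  have h : ∀ x, stdHyperbolic F m x = ∑ i, x (pairFst i) * x (pairSnd i) := fun x ↦ by
    simp [stdHyperbolic, coordMul]
  simp_rw [h, sum_addChar_sum_pairs ψ fun _ a b ↦ a * b, sum_addChar_mul hψ]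
  simp

/-- A nontrivial zero splits off a linear factor. Both factors vanish at the origin, so neither is a
unit. -/
theorem binary_eq_zero_of_irreducible {F : Type*} [Field F] {a b c : F}
    (h : Irreducible (binaryForm a b c)) {x y : F}
    (hxy : a * (x * x) + b * (x * y) + c * (y * y) = 0) : x = 0 ∧ y = 0 := by
  by_contra hne
  let ev : MvPolynomial (Fin 2) F →+* F := MvPolynomial.eval fun _ ↦ 0
  have hunit : ∀ p : MvPolynomial (Fin 2) F, ev p = 0 → ¬IsUnit p := fun p hp hu ↦
    not_isUnit_zero (hp ▸ hu.map ev)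
  suffices ∃ p r : MvPolynomial (Fin 2) F, binaryForm a b c = p * r ∧ ev p = 0 ∧ ev r = 0 by
    obtain ⟨p, r, hpr, hp, hr⟩ := this
    exact (h.isUnit_or_isUnit hpr).elim (hunit p hp) (hunit r hr)
  by_cases hy : y = 0
  · have hx : x ≠ 0 := fun hx ↦ hne ⟨hx, hy⟩
    have ha : a = 0 := by simpa [hy, hx] using hxy
    refine ⟨MvPolynomial.X 1, MvPolynomial.C b * MvPolynomial.X 0 +
      MvPolynomial.C c * MvPolynomial.X 1, ?_, by simp [ev], by simp [ev]⟩
    rw [binaryForm, ha, map_zero]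
    ring
  · let s := x / y
    have hs : a * (s * s) + b * s + c = 0 := by
      simp only [s]
      field_simp
      linear_combination hxy
    refine ⟨MvPolynomial.X 0 - MvPolynomial.C s * MvPolynomial.X 1,
      MvPolynomial.C a * MvPolynomial.X 0 + MvPolynomial.C (b + a * s) * MvPolynomial.X 1,
      ?_, by simp [ev], by simp [ev]⟩
    obtain rfl : c = -(a * (s * s) + b * s) := by linear_combination hs
    rw [binaryForm]
    simp only [map_neg, map_add, map_mul]
    ring

theorem sum_addChar_binary_of_irreducible (hψ : ψ.IsPrimitive) {a b c : F}
    (h : Irreducible (binaryForm a b c)) :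
    ∑ p : F × F, ψ (a * (p.1 * p.1) + b * (p.1 * p.2) + c * (p.2 * p.2)) =
      -(Fintype.card F : ℂ) := by
  classical
  let Q : QuadraticForm F (F × F) :=
    a • linMulLin (LinearMap.fst F F F) (LinearMap.fst F F F) +
      b • linMulLin (LinearMap.fst F F F) (LinearMap.snd F F F) +
      c • linMulLin (LinearMap.snd F F F) (LinearMap.snd F F F)
  have hQ : Q.Anisotropic := fun p hp ↦
    Prod.ext_iff.2 (binary_eq_zero_of_irreducible h hp)
  have h1 := (hQ.hasGaussSign hψ (by simp)).sum_eq 1 one_ne_zero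
  simp only [one_mul, Int.cast_neg, Int.cast_one, pow_one, neg_mul] at h1
  exact h1

theorem sum_addChar_stdElliptic (hψ : ψ.IsPrimitive) (hm : 0 < m) {a b c : F}
    (h : Irreducible (binaryForm a b c)) :
    ∑ x, ψ (stdElliptic F m a b c x) = -(Fintype.card F : ℂ) ^ m := by
  have hx : ∀ x, stdElliptic F m a b c x = ∑ i : Fin m, (fun u v ↦ if (i : ℕ) + 1 < m then u * v
      else a * (u * u) + b * (u * v) + c * (v * v)) (x (pairFst i)) (x (pairSnd i)) := fun x ↦ by
    rw [stdElliptic, _root_.sum_apply]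
    refine sum_congr rfl fun i _ ↦ ?_
    dsimp only
    split_ifs <;> simp [coordMul]
  simp_rw [hx]
  rw [sum_addChar_sum_pairs ψ fun (i : Fin m) u v ↦ if (i : ℕ) + 1 < m then u * v
      else a * (u * u) + b * (u * v) + c * (v * v)]
  -- The condition `i + 1 < m` fails only at the last index: the hyperbolic pairs give `q ^ k` and
  -- the anisotropic pair gives `-q`.
  obtain ⟨k, rfl⟩ : ∃ k, m = k + 1 := ⟨m - 1, by omega⟩
  rw [Fin.prod_univ_castSucc]
  simp [sum_addChar_mul hψ, sum_addChar_binary_of_irreducible hψ h, pow_succ]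

variable {Q : QuadraticForm F (Fin (2 * m) → F)} {ε : ℤ}

namespace HasGaussSign

theorem eq_one_of_isHyperbolicForm (h : HasGaussSign ψ Q m ε) (hψ : ψ.IsPrimitive)
    (hQ : IsHyperbolicForm Q) : ε = 1 := by
  obtain ⟨g⟩ := hQ
  have h1 := h.sum_eq 1 one_ne_zero
  simp only [one_mul] at h1
  rw [g.sum_comp ψ, sum_addChar_stdHyperbolic hψ] at h1
  have hq : (Fintype.card F : ℂ) ^ m ≠ 0 := pow_ne_zero _ (by exact_mod_cast Fintype.card_ne_zero)
  exact_mod_cast (mul_eq_right₀ hq).1 h1.symm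

theorem eq_neg_one_of_isEllipticForm (h : HasGaussSign ψ Q m ε) (hψ : ψ.IsPrimitive)
    (hm : 0 < m) (hQ : IsEllipticForm Q) : ε = -1 := by
  obtain ⟨a, b, c, hirr, ⟨g⟩⟩ := hQ
  have h1 := h.sum_eq 1 one_ne_zero
  simp only [one_mul] at h1
  rw [g.sum_comp ψ, sum_addChar_stdElliptic hψ hm hirr, neg_eq_neg_one_mul] at h1
  have hq : (Fintype.card F : ℂ) ^ m ≠ 0 := pow_ne_zero _ (by exact_mod_cast Fintype.card_ne_zero)
  exact_mod_cast (mul_right_cancel₀ hq h1).symm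

end HasGaussSign

end

/-! ### Strong regularity of Cayley graphs as counting conditions -/

section

variable {G : Type*} [AddCommGroup G] [Fintype G] {D : Set G} [DecidablePred (· ∈ D)]

theorem IsConnectionSet.card_commonNeighbors (hD : IsConnectionSet D) (u v : G)
    [Fintype ((SimpleGraph.addCayley D).commonNeighbors u v)] :
    Fintype.card ((SimpleGraph.addCayley D).commonNeighbors u v) =
      #{x | x ∈ D ∧ x - (v - u) ∈ D} := by
  rw [← Set.toFinset_card]
  refine card_bij (fun z _ ↦ z - u) (fun z hz ↦ ?_) (fun _ _ _ _ h ↦ sub_left_injective h)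
    fun x hx ↦ ⟨x + u, ?_, add_sub_cancel_right x u⟩
  · rw [Set.mem_toFinset, SimpleGraph.mem_commonNeighbors, SimpleGraph.adj_comm,
      hD.addCayley_adj_iff, SimpleGraph.adj_comm, hD.addCayley_adj_iff] at hz
    simpa using hz
  · rw [Set.mem_toFinset, SimpleGraph.mem_commonNeighbors, SimpleGraph.adj_comm,
      hD.addCayley_adj_iff, SimpleGraph.adj_comm, hD.addCayley_adj_iff, add_sub_cancel_right]
    rw [mem_filter, sub_sub_eq_add_sub] at hx
    exact hx.2

theorem IsConnectionSet.degree_addCayley (hD : IsConnectionSet D) (u : G)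
    [Fintype ((SimpleGraph.addCayley D).neighborSet u)] :
    (SimpleGraph.addCayley D).degree u = #{x | x ∈ D} := by
  refine card_bij (fun z _ ↦ z - u) (fun z hz ↦ ?_) (fun _ _ _ _ h ↦ sub_left_injective h)
    fun x hx ↦ ⟨x + u, ?_, add_sub_cancel_right x u⟩
  · rw [SimpleGraph.mem_neighborFinset, SimpleGraph.adj_comm, hD.addCayley_adj_iff] at hz
    simpa using hz
  · rw [SimpleGraph.mem_neighborFinset, SimpleGraph.adj_comm, hD.addCayley_adj_iff,
      add_sub_cancel_right]
    simpa using hx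

theorem IsConnectionSet.isSRGWith_addCayley_iff (hD : IsConnectionSet D)
    [DecidableRel (SimpleGraph.addCayley D).Adj] {v k l μ : ℕ} :
    (SimpleGraph.addCayley D).IsSRGWith v k l μ ↔ Fintype.card G = v ∧ #{x | x ∈ D} = k ∧
      (∀ d ∈ D, #{x | x ∈ D ∧ x - d ∈ D} = l) ∧
      ∀ d, d ≠ 0 → d ∉ D → #{x | x ∈ D ∧ x - d ∈ D} = μ := by
  have hadj : ∀ u w, (SimpleGraph.addCayley D).Adj u w ↔ w - u ∈ D := fun u w ↦ by
    rw [SimpleGraph.adj_comm, hD.addCayley_adj_iff]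
  constructor
  · rintro ⟨h1, h2, h3, h4⟩
    refine ⟨h1, ?_, fun d hd ↦ ?_, fun d hd0 hd ↦ ?_⟩
    · rw [← h2 0, hD.degree_addCayley]
    · rw [← h3 0 d ((hadj _ _).2 (by rwa [sub_zero])), hD.card_commonNeighbors, sub_zero]
    · rw [← h4 hd0.symm (fun h ↦ hd (by simpa using (hadj _ _).1 h)), hD.card_commonNeighbors,
        sub_zero]
  · rintro ⟨h1, h2, h3, h4⟩
    refine ⟨h1, fun u ↦ ?_, fun u w huw ↦ ?_, fun u w hne huw ↦ ?_⟩
    · rw [hD.degree_addCayley, h2]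
    · rw [hD.card_commonNeighbors, h3 _ ((hadj _ _).1 huw)]
    · rw [hD.card_commonNeighbors,
        h4 _ (sub_ne_zero.2 hne.symm) fun h ↦ huw ((hadj _ _).2 h)]

theorem IsConnectionSet.isStronglyRegular_addCayley_iff (hD : IsConnectionSet D) {v k l μ : ℕ} :
    IsStronglyRegular (SimpleGraph.addCayley D) v k l μ ↔
      (Fintype.card G = v ∧ #{x | x ∈ D} = k ∧ (∀ d ∈ D, #{x | x ∈ D ∧ x - d ∈ D} = l) ∧
        ∀ d, d ≠ 0 → d ∉ D → #{x | x ∈ D ∧ x - d ∈ D} = μ) ∧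
      (∃ d, d ∈ D) ∧ ∃ d, d ≠ 0 ∧ d ∉ D := by
  refine and_congr (@IsConnectionSet.isSRGWith_addCayley_iff _ _ _ _ _ hD
      (fun _ _ ↦ Classical.propDecidable _) _ _ _ _)
    (and_congr ?_ ?_)
  · rw [← not_iff_not, not_not]
    push Not
    constructor
    · intro hb d hd
      have h : (SimpleGraph.addCayley D).Adj d 0 := (hD.addCayley_adj_iff d 0).2 (by rwa [sub_zero])
      rw [hb] at h
      exact h
    · intro h
      refine SimpleGraph.ext ?_
      funext u w
      exact propext ⟨fun hadj ↦ h _ ((hD.addCayley_adj_iff u w).1 hadj), False.elim⟩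
  · rw [← not_iff_not, not_not]
    push Not
    constructor
    · intro ht d hd0
      have h := (hD.addCayley_adj_iff d 0).1 (by rw [ht]; exact hd0)
      rwa [sub_zero] at h
    · intro h
      refine SimpleGraph.ext ?_
      funext u w
      exact propext ⟨fun hadj ↦ hadj.ne, fun hne ↦
        (hD.addCayley_adj_iff u w).2 (h _ (sub_ne_zero.2 hne))⟩

end

theorem QuadraticMap.isConnectionSet_preimage {F V : Type*} [Field F] [AddCommGroup V] [Module F V]
    (Q : QuadraticForm F V) {E : Set F} (hE : (0 : F) ∉ E) : IsConnectionSet {x | Q x ∈ E} :=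
  ⟨by simpa using hE, fun x hx ↦ by simpa using hx⟩

/-! ### Transfer from the norm form to `Q` -/

section

variable {F V K : Type*} [Field F] [Fintype F] [AddCommGroup V] [Module F V] [Fintype V]
  {ψ : AddChar F ℂ} {Q : QuadraticForm F V} {m : ℕ} {ε : ℤ}

namespace HasGaussSign

theorem card_mul_card_preimage [DecidableEq F] (h : HasGaussSign ψ Q m ε) (hψ : ψ.IsPrimitive)
    {E : Finset F} (hE : (0 : F) ∉ E) :
    (Fintype.card F : ℤ) * #{x | Q x ∈ E} =
      #E * ((Fintype.card F : ℤ) ^ (2 * m) - ε * (Fintype.card F : ℤ) ^ m) := by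
  have h1 : #{x | Q x ∈ E} = ∑ t ∈ E, #{x | Q x = t} := by
    rw [card_eq_sum_card_fiberwise (f := Q) (t := E)]
    · refine sum_congr rfl fun t ht ↦ congrArg card ?_
      ext x
      simp only [mem_filter, mem_univ, true_and]
      exact ⟨fun h ↦ h.2, fun h ↦ ⟨h ▸ ht, h⟩⟩
    · intro x hx
      simpa using hx
  rw [h1, Nat.cast_sum, mul_sum, ← nsmul_eq_mul, ← sum_const]
  refine sum_congr rfl fun t ht ↦ ?_
  rw [h.card_mul_card_fiber hψ, if_neg (ne_of_mem_of_not_mem ht hE)]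
  ring

/-- An empty fibre would give `q ^ m * (q ^ m - ε) = 0`, impossible as `q ^ m > 1`. -/
theorem exists_apply_eq (h : HasGaussSign ψ Q m ε) (hψ : ψ.IsPrimitive) (hε : ε = 1 ∨ ε = -1)
    (hm : 0 < m) {t : F} (ht : t ≠ 0) : ∃ d, Q d = t := by
  classical
  have h1 := h.card_mul_card_fiber hψ t
  rw [if_neg ht, pow_mul'] at h1
  have hq : (1 : ℤ) < (Fintype.card F : ℤ) ^ m :=
    one_lt_pow₀ (by exact_mod_cast Fintype.one_lt_card) hm.ne'
  by_contra! hne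
  rw [filter_eq_empty_iff.2 fun x _ ↦ hne x] at h1
  rw [card_empty, Nat.cast_zero, mul_zero] at h1
  rcases hε with rfl | rfl <;> nlinarith

variable [AddCommGroup K] [Module F K] [Fintype K] {N : QuadraticForm F K}

/-- The Cayley graph attached to `E` inherits strong regularity from the one attached to `E` and
the anisotropic binary form `N`. -/
theorem isStronglyRegularOfType (h : HasGaussSign ψ Q m ε) (hψ : ψ.IsPrimitive)
    (hε : ε = 1 ∨ ε = -1) (hm : 0 < m) (hN : HasGaussSign ψ N 1 (-1))
    {E : Set F} (hE : (0 : F) ∉ E)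
    (hsrg : IsNegLatinSquareType (SimpleGraph.addCayley {x | N x ∈ E})) :
    IsStronglyRegularOfType ε (SimpleGraph.addCayley {x | Q x ∈ E}) := by
  classical
  have hDQ := Q.isConnectionSet_preimage hE
  obtain ⟨v, k, l, μ, n, r₀, hG, hv, hk, hl, hμ⟩ := hsrg
  rw [(N.isConnectionSet_preimage hE).isStronglyRegular_addCayley_iff] at hG
  obtain ⟨⟨hcard, hdeg, hadj, hnadj⟩, ⟨c₀, hc₀⟩, c₁, hc₁0, hc₁⟩ := hG
  simp only [Set.mem_ofPred_eq] at hdeg hadj hnadj hc₀ hc₁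
  set q : ℤ := (Fintype.card F : ℤ) with hq
  have hq1 : 1 < q := by
    rw [hq]
    exact_mod_cast Fintype.one_lt_card
  obtain ⟨E, rfl⟩ : ∃ E' : Finset F, E = E' := ⟨E.toFinset, by simp⟩
  simp only [mem_coe] at hdeg hadj hnadj hc₀ hc₁ hE
  -- The fibre formula with `m = 1` and sign `-1` gives `N` exactly one zero.
  have hN0 : ∀ c, c ≠ 0 → N c ≠ 0 := fun c hc h0 ↦ by
    have hfib := hN.card_mul_card_fiber hψ 0
    rw [if_pos rfl, ← hq] at hfib
    have h2 : ({0, c} : Finset K) ⊆ univ.filter fun x ↦ N x = 0 := by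
      intro x hx
      rcases mem_insert.1 hx with rfl | hx
      · simp
      · rw [mem_singleton.1 hx]
        simpa using h0
    have h3 := card_le_card h2
    rw [card_pair hc.symm] at h3
    have h4 : (2 : ℤ) ≤ #{x | N x = 0} := by exact_mod_cast h3
    have h5 : q * #{x | N x = 0} = q := by linear_combination hfib
    nlinarith
  have hn : (n : ℤ) = q := by
    have h1 := hN.card_eq
    rw [hcard, hv, mul_one] at h1
    rw [hq]
    exact_mod_cast (Nat.pow_left_injective (by norm_num : (2 : ℕ) ≠ 0)) h1
  -- The degree is `r₀ * (q + 1)` by hypothesis and `#E * (q + 1)` by counting fibres.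
  have hr : (r₀ : ℤ) = #E := by
    have h1 := hN.card_mul_card_preimage hψ hE
    rw [hdeg, hk, hn, ← hq] at h1
    have h3 : q * (q + 1) ≠ 0 := by positivity
    apply mul_right_cancel₀ h3
    linear_combination h1
  rw [hn, hr] at hl
  rw [hr] at hμ
  obtain ⟨j, rfl⟩ : ∃ j, m = j + 1 := ⟨m - 1, by omega⟩
  -- This is the new `r`: counting fibres gives degree `R * (q ^ (j + 1) - ε)`, where `m = j + 1`.
  set R : ℕ := Fintype.card F ^ j * #E with hR
  have hR' : (R : ℤ) = q ^ j * #E := by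
    rw [hR, hq]
    push_cast
    rfl
  -- Nonzero `d` with `Q d = 0` fall in the second case, since `0 ∉ E`, and give the same value `R ^
  -- 2 - ε * R`.
  have hcount : ∀ d, d ≠ 0 → (#{x | Q x ∈ E ∧ Q (x - d) ∈ E} : ℤ) =
      if Q d ∈ E then ε * q ^ (j + 1) + (R : ℤ) ^ 2 - 3 * ε * R else (R : ℤ) ^ 2 - ε * R := by
    intro d hd
    have hq2 : q ^ 2 ≠ 0 := by positivity
    apply mul_left_cancel₀ hq2
    by_cases h0 : Q d = 0
    · rw [if_neg (by rwa [h0]), h.card_pair_of_eq_zero hψ hd h0 hE, hR']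
      ring
    · obtain ⟨c, hc⟩ := hN.exists_apply_eq hψ (Or.inr rfl) one_pos h0
      have hc0 : c ≠ 0 := by
        rintro rfl
        exact h0 (by rw [← hc, QuadraticMap.map_zero])
      rw [h.card_pair_of_eq hψ hN hd hc0 hc.symm E, hR']
      split_ifs with hdE
      · rw [hadj c (by rwa [hc]), hl]
        ring
      · rw [hnadj c hc0 (by rwa [hc]), hμ]
        ring
  have hQ0 : ∀ c d, c ≠ 0 → Q d = N c → d ≠ 0 := by
    rintro c d hc hd rfl
    exact hN0 c hc (by rw [← hd, QuadraticMap.map_zero])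
  have hc₀0 : c₀ ≠ 0 := by
    rintro rfl
    exact hE (by simpa using hc₀)
  -- `c₀` and `c₁` witness that the graph of `N` is neither edgeless nor complete. Vectors with the
  -- same form values do so for `Q`, and also realise `λ` and `μ` as natural numbers.
  obtain ⟨d₀, hd₀⟩ := h.exists_apply_eq hψ hε hm (hN0 c₀ hc₀0)
  obtain ⟨d₁, hd₁⟩ := h.exists_apply_eq hψ hε hm (hN0 c₁ hc₁0)
  have hd₁0 := hQ0 c₁ d₁ hc₁0 hd₁
  have hl' := hcount d₀ (hQ0 c₀ d₀ hc₀0 hd₀)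
  rw [if_pos (by rwa [hd₀])] at hl'
  have hμ' := hcount d₁ hd₁0
  rw [if_neg (by rwa [hd₁])] at hμ'
  refine ⟨Fintype.card V, #{x | Q x ∈ E}, #{x | Q x ∈ E ∧ Q (x - d₀) ∈ E},
    #{x | Q x ∈ E ∧ Q (x - d₁) ∈ E}, Fintype.card F ^ (j + 1), R,
    hDQ.isStronglyRegular_addCayley_iff.2 ⟨⟨rfl, rfl, fun d hd ↦ ?_, fun d hd0 hd ↦ ?_⟩,
      ⟨d₀, ?_⟩, d₁, hd₁0, ?_⟩, ?_, ?_, ?_, hμ'⟩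
  · have h1 := hcount d fun h0 ↦ hDQ.1 (h0 ▸ hd)
    rw [if_pos (show Q d ∈ E from hd), ← hl', Nat.cast_inj] at h1
    simpa only [Set.mem_ofPred_eq, mem_coe] using h1
  · have h1 := hcount d hd0
    rw [if_neg (show Q d ∉ E from hd), ← hμ', Nat.cast_inj] at h1
    simpa only [Set.mem_ofPred_eq, mem_coe] using h1
  · simpa [hd₀] using hc₀
  · simpa [hd₁] using hc₁
  · rw [h.card_eq, pow_mul']
  · have h1 := h.card_mul_card_preimage hψ hE
    have hq0 : q ≠ 0 := by positivity
    apply mul_left_cancel₀ hq0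
    rw [hR']
    push_cast
    rw [h1]
    ring
  · rw [hl']
    push_cast
    ring

end HasGaussSign

/-- The norm is the determinant of a 2 × 2 matrix whose entries are linear in `x`. -/
theorem exists_quadraticForm_eq_norm {F K : Type*} [Field F] [Field K] [Algebra F K]
    (hK : Module.finrank F K = 2) : ∃ N : QuadraticForm F K, ∀ x, N x = Algebra.norm F x := by
  have : FiniteDimensional F K := Module.finite_of_finrank_pos (by omega)
  let b := Module.finBasisOfFinrankEq F K hK
  let entry (i j : Fin 2) : K →ₗ[F] F :=
    Matrix.entryLinearMap F F i j ∘ₗ (Algebra.leftMulMatrix b).toLinearMap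
  refine ⟨linMulLin (entry 0 0) (entry 1 1) - linMulLin (entry 0 1) (entry 1 0), fun x ↦ ?_⟩
  rw [Algebra.norm_eq_matrix_det b, Matrix.det_fin_two]
  rfl

end

/-! ### Cyclotomic classes and the norm map -/

section

variable {K : Type*} [Field K]

/-- Because `e` divides the order of `γ`, the residue of the exponent modulo `e` is well defined. -/
theorem zpow_mem_cyclotomicUnion_iff {γ : Kˣ} {e : ℕ} (he : e ∣ orderOf γ) {I : Finset ℕ} (j : ℤ) :
    ((γ ^ j : Kˣ) : K) ∈ cyclotomicUnion γ e I ↔ ∃ i ∈ I, (e : ℤ) ∣ j - i := by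
  simp only [cyclotomicUnion, cyclotomicClass, Set.mem_iUnion, Set.mem_ofPred_eq, exists_prop,
    Subgroup.mem_zpowers_iff]
  refine exists_congr fun i ↦ and_congr_right fun _ ↦ ?_
  constructor
  · rintro ⟨_, ⟨k, rfl⟩, h⟩
    have h1 : γ ^ j = γ ^ ((i : ℤ) + e * k) := by
      rw [Units.ext h, zpow_add, zpow_mul, zpow_natCast, zpow_natCast]
    have h2 := (orderOf_dvd_sub_iff_zpow_eq_zpow).2 h1
    have h3 : (e : ℤ) ∣ j - (i + e * k) := (Int.natCast_dvd_natCast.2 he).trans h2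
    have h4 : j - i = (j - (i + e * k)) + e * k := by ring
    rw [h4]
    exact dvd_add h3 (dvd_mul_right _ _)
  · rintro ⟨k, hk⟩
    refine ⟨_, ⟨k, rfl⟩, ?_⟩
    rw [← zpow_natCast γ e, ← zpow_mul, ← hk, ← zpow_natCast, ← zpow_add, add_sub_cancel]

theorem zero_notMem_cyclotomicUnion (γ : Kˣ) (e : ℕ) (I : Finset ℕ) :
    (0 : K) ∉ cyclotomicUnion γ e I := by
  simp only [cyclotomicUnion, cyclotomicClass, Set.mem_iUnion, Set.mem_ofPred_eq, not_exists,
    not_and]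
  exact fun i _ u _ h ↦ (γ ^ i * u).ne_zero h.symm

/-- The norm is surjective on units, so `ω` generates `Fˣ` and `e` divides its order. Since `γ ^ j`
has norm `ω ^ j`, both memberships are the same condition on `j` modulo `e`. -/
theorem cyclotomicUnion_eq_preimage_norm {F : Type*} [Field F] [Fintype F] [Fintype K]
    [Algebra F K] {γ : Kˣ} (hγ : ∀ x : Kˣ, x ∈ Subgroup.zpowers γ) {ω : Fˣ}
    (hω : (ω : F) = Algebra.norm F (γ : K)) {e : ℕ} (he : e ∣ Fintype.card F - 1)
    (I : Finset ℕ) :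
    cyclotomicUnion γ e I = {x | Algebra.norm F x ∈ cyclotomicUnion ω e I} := by
  have hω' : Units.map (Algebra.norm F : K →* F) γ = ω := Units.ext hω.symm
  have hωgen : ∀ y : Fˣ, y ∈ Subgroup.zpowers ω := fun y ↦ by
    obtain ⟨x, rfl⟩ := FiniteField.unitsMap_norm_surjective F K y
    obtain ⟨j, rfl⟩ := hγ x
    exact ⟨j, by rw [← hω']; exact (map_zpow _ γ j).symm⟩
  have hordω : orderOf ω = Fintype.card F - 1 := by
    rw [orderOf_eq_card_of_forall_mem_zpowers hωgen, Nat.card_units, Nat.card_eq_fintype_card]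
  have heω : e ∣ orderOf ω := hordω ▸ he
  have heγ : e ∣ orderOf γ := heω.trans (hω' ▸ orderOf_map_dvd _ γ)
  ext x
  rw [Set.mem_ofPred_eq]
  rcases eq_or_ne x 0 with rfl | hx
  · rw [Algebra.norm_zero]
    exact iff_of_false (zero_notMem_cyclotomicUnion _ _ _) (zero_notMem_cyclotomicUnion _ _ _)
  · obtain ⟨j, hj⟩ := hγ (Units.mk0 x hx)
    have h1 : x = ((γ ^ j : Kˣ) : K) := congrArg Units.val hj.symm
    have h2 : Algebra.norm F ((γ ^ j : Kˣ) : K) = ((ω ^ j : Fˣ) : F) := by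
      rw [← hω', ← map_zpow]
      rfl
    rw [h1, h2, zpow_mem_cyclotomicUnion_iff heγ, zpow_mem_cyclotomicUnion_iff heω]

end

end

/-- `F` is the field with `q = Fintype.card F` elements, `K` its quadratic extension, `γ` a primitive
element of `K`, and `ω = Norm γ`. -/
theorem theorem4p3 {F K : Type*} [Field F] [Fintype F] [Field K] [Fintype K] [Algebra F K]
    (hK : Module.finrank F K = 2)
    (γ : Kˣ) (hγ : ∀ x : Kˣ, x ∈ Subgroup.zpowers γ)
    (ω : Fˣ) (hω : (ω : F) = Algebra.norm F (γ : K))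
    (e : ℕ) (he : 1 < e) (heq : e ∣ Fintype.card F - 1)
    (I : Finset ℕ) (hI : I ⊆ Finset.range e)
    (hsrg : IsNegLatinSquareType (SimpleGraph.addCayley (cyclotomicUnion γ e I)))
    (m : ℕ) (hm : 0 < m) (Q : QuadraticForm F (Fin (2 * m) → F)) (hQ : IsNonsingularForm Q) :
    IsConnectionSet {x | Q x ∈ cyclotomicUnion ω e I} ∧
    (∃ v k l μ : ℕ,
      IsStronglyRegular (SimpleGraph.addCayley {x | Q x ∈ cyclotomicUnion ω e I}) v k l μ) ∧
    (IsHyperbolicForm Q →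
      IsLatinSquareType (SimpleGraph.addCayley {x | Q x ∈ cyclotomicUnion ω e I})) ∧
    (IsEllipticForm Q →
      IsNegLatinSquareType (SimpleGraph.addCayley {x | Q x ∈ cyclotomicUnion ω e I})) := by
  classical
  have hψ := AddChar.FiniteField.primitiveChar_to_Complex_isPrimitive F
  set E := cyclotomicUnion ω e I
  have hE : (0 : F) ∉ E := zero_notMem_cyclotomicUnion ω e I
  obtain ⟨N, hN⟩ := exists_quadraticForm_eq_norm hK
  have : FiniteDimensional F K := Module.finite_of_finrank_pos (by omega)
  -- The norm of a field extension vanishes only at 0, so `N` is anisotropic of rank 2 and has sign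
  -- `-1`.
  have hNsign := QuadraticMap.Anisotropic.hasGaussSign hψ
    (Q := N) (fun x hx ↦ Algebra.norm_eq_zero_iff.1 (hN x ▸ hx)) hK
  rw [cyclotomicUnion_eq_preimage_norm hγ hω heq I] at hsrg
  simp_rw [← hN] at hsrg
  obtain ⟨ε, hε, hQε⟩ := hQ.exists_hasGaussSign hψ (m := m) (by simp)
  have hmain := hQε.isStronglyRegularOfType hψ hε hm hNsign hE hsrg
  refine ⟨Q.isConnectionSet_preimage hE, ?_, fun hhyp ↦ ?_, fun hell ↦ ?_⟩
  · obtain ⟨v, k, l, μ, -, -, h, -⟩ := hmain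
    exact ⟨v, k, l, μ, h⟩
  · rwa [hQε.eq_one_of_isHyperbolicForm hψ hhyp] at hmain
  · rwa [hQε.eq_neg_one_of_isEllipticForm hψ hm hell] at hmain
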